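/- A median algebra is a set $M$ with a ternary operation $(a,b,c)\mapsto abc$ such that $aab=a$, $abc=bac=acb$ and $ab(cde)=(abc)(abd)e$ for all $a,b,c,d,e\in M$. Its interval between $a$ and $b$ is $[a,b]=\{x\in M : abx=x\}$; a subset $C\subseteq M$ is convex if $[a,b]\subseteq C$ for all $a,b\in C$; the interval $[a,b]$ is additive if $[a,x]\cup[x,b]=[a,b]$ for every $x\in[a,b]$. The rank of $M$ is the largest $n$ for which there is an injective median-preserving map $\{0,1\}^n\to M$, where $\{0,1\}^n$ carries the coordinatewise majority operation. A topological median algebra is a median algebra with a Hausdorff topology for which the map $M^3\to M$, $(a,b,c)\mapsto abc$, is continuous. An additive ray based at $a\in M$ is a closed convex subset $R\subseteq M$ for which there is a homeomorphism $[0,\infty)\to R$ sending $0$ to $a$, and such that $[a,x]$ is additive for every $x\in R$. For $K\subseteq M$ with $a\in K$, a full additive interval based at $a$ in $K$ is an additive interval $[a,x]$ that is equal to $R\cap K$ for some additive ray $R$ based at $a$. **Proposition.** Let $M$ be a locally compact, connected topological median algebra of finite rank such that for all $a,b\in M$ with $[a,b]$ additive there is an additive ray based at $a$ that contains $[a,b]$.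 Then for every $a\in M$ there is a compact convex neighbourhood $K$ of $a$ such that the number of full additive intervals based at $a$ in $K$ is finite. -/

import Mathlib

open Set Topology
open scoped NNReal

/-- A median algebra: a set with a ternary operation `med` satisfying the majority rule,
symmetry and distributivity. -/
class MedianAlgebra (M : Type*) where
  /-- The median of three points. -/
  med : M → M → M → M
  med_self : ∀ a b, med a a b = a
  med_swap_left : ∀ a b c, med a b c = med b a c
  med_swap_right : ∀ a b c, med a b c = med a c b
  med_distrib : ∀ a b c d e, med a b (med c d e) = med (med a b c) (med a b d) e

namespace MedianAlgebra

/-- The two-point median algebra, with the majority vote as its operation. -/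
instance instBool : MedianAlgebra Bool where
  med a b c := (a && b) || (b && c) || (a && c)
  med_self := by decide
  med_swap_left := by decide
  med_swap_right := by decide
  med_distrib := by decide

/-- A product of median algebras with the coordinatewise operation. -/
instance instPi {ι : Type*} {A : ι → Type*} [∀ i, MedianAlgebra (A i)] :
    MedianAlgebra (∀ i, A i) where
  med a b c i := med (a i) (b i) (c i)
  med_self a b := funext fun i => med_self (a i) (b i)
  med_swap_left a b c := funext fun i => med_swap_left (a i) (b i) (c i)
  med_swap_right a b c := funext fun i => med_swap_right (a i) (b i) (c i)
  med_distrib a b c d e := funext fun i => med_distrib (a i) (b i) (c i) (d i) (e i)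

/-- A median embedding: an injective map that preserves medians. -/
def IsMedianEmbedding {A B : Type*} [MedianAlgebra A] [MedianAlgebra B] (f : A → B) : Prop :=
  Function.Injective f ∧ ∀ x y z, f (med x y z) = med (f x) (f y) (f z)

/-- The rank of `M`: the largest `n` such that the median `n`-cube `{0,1}ⁿ` embeds in `M`
(equal to `⊤` if there are such `n` without bound). -/
noncomputable def rank (M : Type*) [MedianAlgebra M] : ℕ∞ :=
  ⨆ n ∈ {n : ℕ | ∃ f : (Fin n → Bool) → M, IsMedianEmbedding f}, (n : ℕ∞)

variable {M : Type*} [MedianAlgebra M]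

/-- The interval `[a, b]` of a median algebra. -/
def interval (a b : M) : Set M := {x | med a b x = x}

/-- A subset is convex if it contains the interval between any two of its points. -/
def IsConvex (C : Set M) : Prop := ∀ a ∈ C, ∀ b ∈ C, interval a b ⊆ C

/-- The interval `[a, b]` is additive: `[a, x] ∪ [x, b] = [a, b]` for each `x ∈ [a, b]`. -/
def IsAdditive (a b : M) : Prop := ∀ x ∈ interval a b, interval a x ∪ interval x b = interval a b

variable [TopologicalSpace M]

/-- An additive ray based at `a`: a closed convex subset, homeomorphic to `[0, ∞)` with `a`
corresponding to `0`, all of whose intervals based at `a` are additive. -/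
def IsAdditiveRay (a : M) (R : Set M) : Prop :=
  (∃ r : ℝ≥0 → M, IsClosedEmbedding r ∧ r 0 = a ∧ range r = R) ∧
    IsConvex R ∧ ∀ x ∈ R, IsAdditive a x

/-- `I` is a full additive interval based at `a` in `K`: an additive interval `[a, x]` that is
the intersection with `K` of an additive ray based at `a`. -/
def IsFullAdditiveInterval (K : Set M) (a : M) (I : Set M) : Prop :=
  (∃ x, I = interval a x ∧ IsAdditive a x) ∧ ∃ R, IsAdditiveRay a R ∧ I = R ∩ K

end MedianAlgebra

/-- A topological median algebra: a Hausdorff space with a continuous median operation. -/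
class TopologicalMedianAlgebra (M : Type*) [TopologicalSpace M] [MedianAlgebra M] : Prop
    extends T2Space M where
  continuous_med : Continuous fun p : M × M × M => MedianAlgebra.med p.1 p.2.1 p.2.2

/-!
The proof has two independent parts.

*Small compact convex neighbourhoods exist.* By local compactness and connectedness, intervals
between points close to `a` are small (`exists_mem_nhds_med_mem`), hence so are the convex hulls of
at most `n` points close to `a`, for each fixed `n` (`exists_mem_nhds_surrounds_mem`). Finite rank
bounds the number of points that are needed: if `x` lies in the hull of a finite set `F` but in the
hull of no proper subset, then the elements of `F` but one yield disjoint nonzero elements of a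
distributive lattice `[x, t]`, and these span a median cube (`exists_isMedianEmbedding_of_minimal`,
`Surrounds.exists_card_le`). So the hull of a small neighbourhood of `a` lies in a compact set, and
its closure is a compact convex neighbourhood (`exists_isCompact_isConvex_mem_nhds`).

*Any compact set `K` meets the claim.* Given infinitely many full additive intervals
`[a, x i] = R i ∩ K`, let the `x i` accumulate at `x`, and follow each `R i` beyond `x i` to a point
`y i` of the frontier of a compact neighbourhood of `x`. The `y i` accumulate at a point `y ≠ x`
with `x` in `[a, y]`. The points `med a (y i) (y j)` of `R i ∩ R j` tend to `y` while the `x i` tend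
to `x`, so `R i` and `R j` still agree beyond `x i` and `x j`. This puts `x i` in
`R j ∩ K = [a, x j]` and `x j` in `[a, x i]`, so that `x i = x j`
(`finite_setOf_isFullAdditiveInterval`).
-/

namespace MedianAlgebra

/-! ### Intervals in a median algebra -/

section Algebra

variable {M : Type*} [MedianAlgebra M]

theorem mem_interval {a b x : M} : x ∈ interval a b ↔ med a b x = x := Iff.rfl

theorem med_rotate (a b c : M) : med a b c = med b c a := by
  rw [med_swap_left, med_swap_right]

theorem med_self_right (a b : M) : med a b b = b := by
  rw [med_rotate, med_self]

theorem med_self_outer (a b : M) : med a b a = a := by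
  rw [med_swap_right, med_self]

theorem med_med_self (a b c : M) : med a b (med a b c) = med a b c := by
  rw [med_distrib, med_self_outer, med_self_right]

theorem med_distrib_full (a b c d e : M) :
    med a b (med c d e) = med (med a b c) (med a b d) (med a b e) := by
  rw [← med_med_self a b (med c d e), med_distrib a b c d e, med_rotate _ _ e, med_rotate _ e _,
    med_distrib a b e, med_med_self, med_rotate]

theorem med_mem_interval (a b c : M) : med a b c ∈ interval a b := med_med_self a b c

theorem left_mem_interval (a b : M) : a ∈ interval a b := med_self_outer a b

theorem right_mem_interval (a b : M) : b ∈ interval a b := med_self_right a b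

theorem interval_self (a : M) : interval a a = {a} := by
  ext x
  rw [mem_interval, med_self, mem_singleton_iff, eq_comm]

theorem med_eq_of_mem_interval {a b x : M} (h : x ∈ interval a b) : med a x b = x := by
  rw [med_swap_right]; exact h

theorem interval_trans {a b x y : M} (hx : x ∈ interval a b) (hy : y ∈ interval a x) :
    y ∈ interval a b := by
  rw [mem_interval] at *
  rw [← hy, med_distrib, hx, med_self_outer]

theorem interval_antisymm {a x y : M} (hx : x ∈ interval a y) (hy : y ∈ interval a x) : x = y := by
  rw [mem_interval] at *
  rw [← hx, med_swap_right, hy]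

/-- The points `c` for which `p` lies between `w` and `c` form a convex set. -/
theorem isConvex_setOf_mem_interval (w p : M) : IsConvex {c | p ∈ interval w c} := by
  intro c hc d hd e he
  rw [mem_ofPred_eq, mem_interval] at *
  rw [med_swap_right] at hc hd ⊢
  rw [← he, med_distrib, hc, hd, med_self]

theorem mem_interval_left_of_mem_right {a x y z : M} (hz : z ∈ interval a y)
    (hx : x ∈ interval z y) : z ∈ interval a x := by
  rw [mem_interval] at *
  rw [← hx, med_swap_right, med_distrib, med_self_right, med_swap_right a z y, hz, med_self]

theorem isConvex_interval (a b : M) : IsConvex (interval a b) := by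
  intro c hc d hd e he
  rw [mem_interval] at *
  rw [← he, med_distrib, hc, hd]

theorem med_mem_interval_of_mem {a b x y : M} (hx : x ∈ interval a b) (hy : y ∈ interval a b)
    (z : M) : med x y z ∈ interval a b :=
  isConvex_interval a b x hx y hy (med_mem_interval x y z)

/-! ### The distributive lattice of an interval, and cubes -/

/-- Seen from an endpoint `s`, an interval `[s, t]` is a distributive lattice with least element
`s`, greatest element `t`, meet `med s` and join `med t`. -/
@[reducible] def intervalDistribLattice (s t : M) : DistribLattice (interval s t) :=
  have rot (u x y : M) : med x y u = med u x y := (med_rotate u x y).symm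
  have assoc (u x y z : M) : med u (med u x y) z = med u x (med u y z) := by
    rw [med_distrib u x u y z, med_self_outer]
  have closed (u : M) (x y : interval s t) : med u (x : M) y ∈ interval s t :=
    rot u x y ▸ med_mem_interval_of_mem x.2 y.2 u
  letI : Min (interval s t) := ⟨fun x y => ⟨med s (x : M) y, closed s x y⟩⟩
  letI : Max (interval s t) := ⟨fun x y => ⟨med t (x : M) y, closed t x y⟩⟩
  have mid (x : interval s t) : med s (x : M) t = x := med_eq_of_mem_interval x.2
  have mid' (x : interval s t) : med t (x : M) s = x := by
    rw [med_rotate, med_swap_left, mid]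
  letI : Lattice (interval s t) := Lattice.mk'
    (fun x y => Subtype.ext (med_swap_right _ _ _))
    (fun x y z => Subtype.ext (assoc _ _ _ _))
    (fun x y => Subtype.ext (med_swap_right _ _ _))
    (fun x y z => Subtype.ext (assoc _ _ _ _))
    (fun x y => Subtype.ext <| show med t (x : M) (med s x y) = x by
      rw [med_distrib, mid', med_self_right, med_self])
    (fun x y => Subtype.ext <| show med s (x : M) (med t x y) = x by
      rw [med_distrib, mid, med_self_right, med_self])
  DistribLattice.ofInfSupLe fun x y z => le_of_eq <| Subtype.ext <|
    show med s (x : M) (med t y z) = med t (med s x y) (med s x z) by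
      have h : med t (med s (x : M) y) (med s x z) ∈ interval s (x : M) :=
        rot t _ _ ▸ med_mem_interval_of_mem (med_mem_interval _ _ _) (med_mem_interval _ _ _) t
      rw [← mem_interval.1 h, med_distrib_full, med_distrib_full s x t, med_med_self,
        med_med_self]

/-- Pairwise disjoint nonzero elements of the lattice `[s, t]` span a median cube: a vertex of the
cube is sent to the join of the elements it selects. -/
theorem exists_isMedianEmbedding_of_disjoint {n : ℕ} {s t : M} (q : Fin n → M)
    (hq : ∀ i, q i ∈ interval s t) (hne : ∀ i, q i ≠ s)
    (hdisj : ∀ i j, i ≠ j → med s (q i) (q j) = s) :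
    ∃ f : (Fin n → Bool) → M, IsMedianEmbedding f := by
  classical
  let _ := intervalDistribLattice s t
  have inf_val (x y : interval s t) : ((x ⊓ y : interval s t) : M) = med s (x : M) y := rfl
  let _ : OrderBot (interval s t) :=
    { bot := ⟨s, left_mem_interval s t⟩
      bot_le := fun x => inf_eq_left.1 <| Subtype.ext <| by rw [inf_val, med_self] }
  let p : Fin n → interval s t := fun i => ⟨q i, hq i⟩
  let φ : (Fin n → Bool) → interval s t := fun v => Finset.univ.sup fun i => if v i then p i else ⊥
  have hp : ∀ i j, i ≠ j → p i ⊓ p j = ⊥ := fun i j h => Subtype.ext (hdisj i j h)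
  have coord (v : Fin n → Bool) (i : Fin n) : p i ⊓ φ v = if v i then p i else ⊥ := by
    rw [Finset.sup_inf_distrib_left]
    apply le_antisymm
    · refine Finset.sup_le fun j _ => ?_
      by_cases hij : i = j
      · subst hij
        exact inf_le_right
      · split_ifs <;> simp [hp i j hij]
    · refine le_trans ?_ (Finset.le_sup (Finset.mem_univ i))
      split_ifs <;> simp
  have φ_le (v : Fin n → Bool) : φ v ≤ φ fun _ => true :=
    Finset.sup_mono_fun fun i _ => by rw [if_pos rfl]; split_ifs <;> simp
  -- an element below the join of all `p i` is determined by its meets with them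
  have recover (u : interval s t) (hu : u ≤ φ fun _ => true) :
      u = Finset.univ.sup fun i => p i ⊓ u := by
    conv_lhs => rw [← inf_eq_left.2 hu, Finset.sup_inf_distrib_left]
    simp [inf_comm]
  have hinj : Function.Injective φ := by
    intro v w h
    funext i
    have h1 : p i ⊓ φ v = p i ⊓ φ w := by rw [h]
    rw [coord, coord] at h1
    have h2 : p i ≠ ⊥ := fun h => hne i (congrArg Subtype.val h)
    cases hv : v i <;> cases hw : w i <;> simp [hv, hw, h2, h2.symm] at h1 ⊢
  refine ⟨fun v => (φ v : M), Subtype.val_injective.comp hinj, fun u v w => ?_⟩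
  let m : interval s t := ⟨med (φ u : M) (φ v) (φ w), med_mem_interval_of_mem (φ u).2 (φ v).2 _⟩
  have inf_m (x : interval s t) :
      ((x ⊓ m : interval s t) : M) = med ((x ⊓ φ u : interval s t) : M)
        ((x ⊓ φ v : interval s t) : M) ((x ⊓ φ w : interval s t) : M) :=
    med_distrib_full _ _ _ _ _
  have hm : m ≤ φ fun _ => true := by
    refine inf_eq_right.1 (Subtype.ext ?_)
    rw [inf_m, inf_eq_right.2 (φ_le u), inf_eq_right.2 (φ_le v), inf_eq_right.2 (φ_le w)]
  suffices h : φ (med u v w) = m from congrArg Subtype.val h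
  rw [recover m hm, recover _ (φ_le _)]
  congr 1
  funext i
  refine Subtype.ext ?_
  rw [inf_m, coord, coord, coord, coord]
  change ((if (u i && v i) || (v i && w i) || (u i && w i) then p i else ⊥ : interval s t) : M) = _
  cases u i <;> cases v i <;> cases w i <;> simp [med_self, med_self_right, med_self_outer]

/-! ### Hulls of finite sets and the rank -/

/-- The gate of a point `x` in the convex hull of a nonempty finite set `F`: a point between `x`
and each element of `F` that lies in every convex set containing `F`. -/
theorem exists_gate (x : M) {F : Finset M} (hF : F.Nonempty) :
    ∃ g, (∀ f ∈ F, g ∈ interval x f) ∧ ∀ D : Set M, IsConvex D → ↑F ⊆ D → g ∈ D := by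
  classical
  induction hF using Finset.Nonempty.cons_induction with
  | singleton f => exact ⟨f, by simp [right_mem_interval], fun D _ h => h (by simp)⟩
  | cons f F hf hF ih =>
    obtain ⟨g, hg, hgD⟩ := ih
    refine ⟨med x f g, ?_, fun D hD h => ?_⟩
    · intro e he
      rw [Finset.mem_cons] at he
      rcases he with rfl | he
      · exact med_mem_interval _ _ _
      · refine interval_trans (hg e he) ?_
        rw [med_swap_right]
        exact med_mem_interval _ _ _
    · rw [Finset.coe_cons, insert_subset_iff] at h
      refine hD f h.1 g (hgD D hD h.2) ?_
      rw [med_rotate]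
      exact med_mem_interval _ _ _

/-- `F` surrounds `x` if `x` is the only point lying between `x` and each element of `F`. For a
nonempty finite set `F` this says that `x` belongs to the convex hull of `F`. -/
def Surrounds (F : Finset M) (x : M) : Prop := ∀ p, (∀ f ∈ F, p ∈ interval x f) → p = x

theorem Surrounds.mem_of_isConvex {F : Finset M} {x : M} (h : Surrounds F x) (hF : F.Nonempty)
    {D : Set M} (hD : IsConvex D) (hFD : ↑F ⊆ D) : x ∈ D := by
  obtain ⟨g, hg, hgD⟩ := exists_gate x hF
  exact h g hg ▸ hgD D hD hFD

theorem surrounds_singleton (x : M) : Surrounds {x} x := fun p hp => by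
  simpa [interval_self] using hp

theorem Surrounds.union [DecidableEq M] {F G : Finset M} {y z w : M} (hy : Surrounds F y)
    (hz : Surrounds G z) (hF : F.Nonempty) (hG : G.Nonempty) (hw : w ∈ interval y z) :
    Surrounds (F ∪ G) w := by
  intro p hp
  have h1 : y ∈ {c | p ∈ interval w c} := hy.mem_of_isConvex hF (isConvex_setOf_mem_interval w p)
    fun f hf => hp f (Finset.mem_union_left _ hf)
  have h2 : z ∈ {c | p ∈ interval w c} := hz.mem_of_isConvex hG (isConvex_setOf_mem_interval w p)
    fun f hf => hp f (Finset.mem_union_right _ hf)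
  have h3 : p ∈ interval w w := isConvex_setOf_mem_interval w p y h1 z h2 hw
  simpa [interval_self] using h3

/-- If no element of a surrounding set of more than `n` points can be dropped, then the median
`n`-cube embeds: the points witnessing the failure are pairwise disjoint in an interval. -/
theorem exists_isMedianEmbedding_of_minimal [DecidableEq M] {F : Finset M} {x : M} {n : ℕ}
    (hF : Surrounds F x) (hmin : ∀ f ∈ F, ¬ Surrounds (F.erase f) x) (hn : n < F.card) :
    ∃ f : (Fin n → Bool) → M, IsMedianEmbedding f := by
  have h1 : ∀ f ∈ F, ∃ p, (∀ e ∈ F.erase f, p ∈ interval x e) ∧ p ≠ x := by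
    intro f hf
    have := hmin f hf
    unfold Surrounds at this
    push Not at this
    exact this
  choose! p hp hpx using h1
  obtain ⟨t, ht⟩ : F.Nonempty := Finset.card_pos.1 (by omega)
  have hcard : n ≤ Fintype.card (F.erase t) := by
    rw [Fintype.card_coe, Finset.card_erase_of_mem ht]
    omega
  obtain ⟨e⟩ : Nonempty (Fin n ↪ F.erase t) :=
    Function.Embedding.nonempty_of_card_le (by simpa using hcard)
  have he (i : Fin n) : (e i : M) ∈ F ∧ (e i : M) ≠ t :=
    ⟨Finset.mem_of_mem_erase (e i).2, Finset.ne_of_mem_erase (e i).2⟩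
  refine exists_isMedianEmbedding_of_disjoint (s := x) (t := t) (fun i => p (e i))
    (fun i => hp _ (he i).1 t (Finset.mem_erase.2 ⟨(he i).2.symm, ht⟩)) (fun i => hpx _ (he i).1)
    fun i j hij => hF _ fun f hf => ?_
  by_cases hfi : f = e i
  · have hne : f ≠ e j := fun h => hij (e.injective (Subtype.ext (hfi.symm.trans h)))
    rw [med_swap_right]
    exact interval_trans (hp _ (he j).1 f (Finset.mem_erase.2 ⟨hne, hf⟩))
      (med_mem_interval _ _ _)
  · exact interval_trans (hp _ (he i).1 f (Finset.mem_erase.2 ⟨hfi, hf⟩))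
      (med_mem_interval _ _ _)

/-- A Carathéodory theorem: if the median `n`-cube does not embed, then a point in the hull of a
finite set is in the hull of at most `n` of its elements. -/
theorem Surrounds.exists_card_le {n : ℕ}
    (hn : ¬ ∃ f : (Fin n → Bool) → M, IsMedianEmbedding f) {F : Finset M} {x : M}
    (hF : Surrounds F x) : ∃ G ⊆ F, G.card ≤ n ∧ Surrounds G x := by
  classical
  induction F using Finset.strongInduction with
  | H F ih =>
    by_cases hmin : ∃ f ∈ F, Surrounds (F.erase f) x
    · obtain ⟨f, hf, h⟩ := hmin
      obtain ⟨G, hG, h'⟩ := ih _ (Finset.erase_ssubset hf) h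
      exact ⟨G, hG.trans (Finset.erase_subset _ _), h'⟩
    · push Not at hmin
      exact ⟨F, Subset.rfl, not_lt.1 fun h =>
        hn (exists_isMedianEmbedding_of_minimal hF hmin h), hF⟩

theorem exists_not_isMedianEmbedding (h : rank M < ⊤) :
    ∃ n : ℕ, ¬ ∃ f : (Fin n → Bool) → M, IsMedianEmbedding f := by
  by_contra! hall
  refine h.ne (ENat.eq_top_iff_forall_ge.2 fun n => ?_)
  exact le_iSup₂ (f := fun (n : ℕ) (_ : n ∈ {n : ℕ | ∃ f : (Fin n → Bool) → M,
    IsMedianEmbedding f}) => (n : ℕ∞)) n (hall n)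

end Algebra

/-! ### Compact convex neighbourhoods -/

section Topology

theorem inter_frontier_nonempty_of_isPreconnected {X : Type*} [TopologicalSpace X] {s t : Set X}
    (hs : IsPreconnected s) (h : (s ∩ t).Nonempty) (h' : (s ∩ tᶜ).Nonempty) :
    (s ∩ frontier t).Nonempty := by
  by_contra! hempty
  have hfr : ∀ x ∈ s, x ∉ frontier t := fun x hx hxt =>
    (hempty ▸ mem_inter hx hxt : x ∈ (∅ : Set X))
  have hint : ∀ x ∈ s, x ∈ closure t → x ∈ interior t := fun x hx hxt =>
    by_contra fun h => hfr x hx ⟨hxt, h⟩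
  obtain ⟨x, hx, hxt⟩ := h
  obtain ⟨y, hy, hyt⟩ := h'
  obtain ⟨z, -, hz, hz'⟩ := hs (interior t) (closure t)ᶜ isOpen_interior
    isClosed_closure.isOpen_compl
    (fun z hz => or_iff_not_imp_right.2 fun h => hint z hz (not_not.1 h))
    ⟨x, hx, hint x hx (subset_closure hxt)⟩
    ⟨y, hy, fun h => hyt (interior_subset (hint y hy h))⟩
  exact hz' (subset_closure (interior_subset hz))

variable {M : Type*} [TopologicalSpace M] [MedianAlgebra M] [TopologicalMedianAlgebra M]

theorem continuous_med {X : Type*} [TopologicalSpace X] {f g h : X → M} (hf : Continuous f)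
    (hg : Continuous g) (hh : Continuous h) : Continuous fun x => med (f x) (g x) (h x) :=
  TopologicalMedianAlgebra.continuous_med.comp (hf.prodMk (hg.prodMk hh))

theorem tendsto_med {ι : Type*} {l : Filter ι} {f g h : ι → M} {x y z : M}
    (hf : Filter.Tendsto f l (𝓝 x)) (hg : Filter.Tendsto g l (𝓝 y)) (hh : Filter.Tendsto h l (𝓝 z)) :
    Filter.Tendsto (fun i => med (f i) (g i) (h i)) l (𝓝 (med x y z)) :=
  (TopologicalMedianAlgebra.continuous_med.tendsto (x, y, z)).comp
    (hf.prodMk_nhds (hg.prodMk_nhds hh))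

theorem IsConvex.closure {C : Set M} (hC : IsConvex C) : IsConvex (closure C) := by
  intro x hx y hy z hz
  rw [← mem_interval.1 hz]
  have hcont : Continuous fun p : M × M => med p.1 p.2 z :=
    continuous_med continuous_fst continuous_snd continuous_const
  exact map_mem_closure₂ (f := fun x y => med x y z) hcont hx hy
    fun x hx y hy => hC x hx y hy (med_mem_interval x y z)

theorem isPreconnected_interval [PreconnectedSpace M] (x y : M) :
    IsPreconnected (interval x y) := by
  have : interval x y = range (med x y) :=
    Subset.antisymm (fun z hz => ⟨z, hz⟩) (range_subset_iff.2 (med_mem_interval x y))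
  rw [this]
  exact isPreconnected_range (continuous_med continuous_const continuous_const continuous_id)

/-- Intervals between points close to `a` stay close to `a`. An interval that leaves a compact
neighbourhood `L` of `a` would, being connected, meet the compact frontier of `L`; but no point of
the frontier lies between points that are close to `a`, because `[a, a] = {a}`. -/
theorem exists_mem_nhds_med_mem [LocallyCompactSpace M] [PreconnectedSpace M] {a : M} {U : Set M}
    (hU : U ∈ 𝓝 a) : ∃ V ∈ 𝓝 a, ∀ y ∈ V, ∀ z ∈ V, ∀ w, med y z w ∈ U := by
  obtain ⟨L, hL, hLU, hLc⟩ := local_compact_nhds hU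
  have hfr : IsCompact (frontier L) := hLc.of_isClosed_subset isClosed_frontier
    hLc.isClosed.frontier_subset
  have hopen : IsOpen {p : (M × M) × M | med p.1.1 p.1.2 p.2 ≠ p.2} :=
    isOpen_ne_fun (continuous_med (by fun_prop) (by fun_prop) (by fun_prop)) (by fun_prop)
  obtain ⟨O, P, hO, -, haO, hP, hOP⟩ := generalized_tube_lemma
    (s := {(a, a)}) isCompact_singleton hfr hopen (by
      rintro ⟨p, c⟩ ⟨rfl, hc⟩
      simp only [mem_ofPred_eq, med_self]
      rintro rfl
      exact hc.2 (mem_interior_iff_mem_nhds.2 hL))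
  have hO' : O ∈ 𝓝 (a, a) := hO.mem_nhds (haO rfl)
  rw [nhds_prod_eq, Filter.mem_prod_self_iff] at hO'
  obtain ⟨V, hV, hVO⟩ := hO'
  refine ⟨V ∩ L, Filter.inter_mem hV hL, fun y hy z hz w => hLU ?_⟩
  by_contra hw
  obtain ⟨c, hc, hcL⟩ := inter_frontier_nonempty_of_isPreconnected
    (isPreconnected_interval y z)
    ⟨y, left_mem_interval y z, hy.2⟩ ⟨_, med_mem_interval y z w, hw⟩
  exact hOP (mk_mem_prod (hVO (mk_mem_prod hy.1 hz.1)) (hP hcL)) hc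

/-- Hulls of at most `n` points close to `a` stay close to `a`. -/
theorem exists_mem_nhds_surrounds_mem [LocallyCompactSpace M] [PreconnectedSpace M] {a : M}
    (n : ℕ) {U : Set M} (hU : U ∈ 𝓝 a) :
    ∃ V ∈ 𝓝 a, ∀ (F : Finset M) (x : M), F.Nonempty → ↑F ⊆ V → F.card ≤ n → Surrounds F x →
      x ∈ U := by
  classical
  suffices h : ∀ (n : ℕ), ∀ U ∈ 𝓝 a, ∃ V ∈ 𝓝 a, ∀ F : Finset M, F.Nonempty → ↑F ⊆ V →
      F.card ≤ n → ∀ x, ∃ g ∈ U, ∀ f ∈ F, g ∈ interval x f by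
    obtain ⟨V, hV, h⟩ := h n U hU
    refine ⟨V, hV, fun F x hF hFV hn hx => ?_⟩
    obtain ⟨g, hg, hgF⟩ := h F hF hFV hn x
    exact hx g hgF ▸ hg
  intro n
  induction n with
  | zero =>
    intro U hU
    exact ⟨U, hU, fun F hF _ hn => absurd hn (by simpa using hF.ne_empty)⟩
  | succ n ih =>
    intro U hU
    obtain ⟨V, hV, hVU⟩ := exists_mem_nhds_med_mem hU
    obtain ⟨W, hW, hWV⟩ := ih V hV
    refine ⟨U ∩ V ∩ W, Filter.inter_mem (Filter.inter_mem hU hV) hW, fun F hF hFW hn x => ?_⟩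
    obtain ⟨f, hf⟩ := hF
    rcases (F.erase f).eq_empty_or_nonempty with h | h
    · refine ⟨f, (hFW hf).1.1, fun e he => ?_⟩
      have : e = f := by
        by_contra hne
        exact Finset.notMem_empty e (h ▸ Finset.mem_erase.2 ⟨hne, he⟩)
      rw [this]
      exact right_mem_interval x f
    · obtain ⟨g, hg, hgF⟩ := hWV (F.erase f) h
        (fun e he => (hFW (Finset.mem_of_mem_erase he)).2)
        (by rw [Finset.card_erase_of_mem hf]; omega) x
      refine ⟨med f g x, hVU f (hFW hf).1.2 g hg x, fun e he => ?_⟩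
      rw [← med_rotate]
      by_cases hef : e = f
      · rw [hef]
        exact med_mem_interval x f g
      · refine interval_trans (hgF e (Finset.mem_erase.2 ⟨hef, he⟩)) ?_
        rw [med_swap_right]
        exact med_mem_interval x g f

/-- The neighbourhood is the closure of the convex hull of a small neighbourhood `V` of `a`; that
hull is the set `C` of points surrounded by at most `n + 1` elements of `V`. -/
theorem exists_isCompact_isConvex_mem_nhds [LocallyCompactSpace M] [PreconnectedSpace M]
    (hrank : rank M < ⊤) (a : M) : ∃ K : Set M, IsCompact K ∧ IsConvex K ∧ K ∈ 𝓝 a := by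
  classical
  obtain ⟨n, hn⟩ := exists_not_isMedianEmbedding hrank
  obtain ⟨L, hLc, hL⟩ := exists_compact_mem_nhds a
  obtain ⟨V, hV, hVL⟩ := exists_mem_nhds_surrounds_mem (n + 1) hL
  let C : Set M := {x | ∃ F : Finset M, F.Nonempty ∧ ↑F ⊆ V ∧ F.card ≤ n + 1 ∧ Surrounds F x}
  have hCL : C ⊆ L := fun x ⟨F, hF, hFV, hFn, hx⟩ => hVL F x hF hFV hFn hx
  have hVC : V ⊆ C := fun x hx => ⟨{x}, by simp, by simpa using hx, by simp, surrounds_singleton x⟩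
  have hC : IsConvex C := by
    rintro y ⟨F, hF, hFV, -, hy⟩ z ⟨G, hG, hGV, -, hz⟩ w hw
    obtain ⟨H, hH, hHn, hwH⟩ := (hy.union hz hF hG hw).exists_card_le hn
    -- `H` may be empty if `M` is a point, hence the additional element
    obtain ⟨f, hf⟩ := hF
    have hFG : (↑(F ∪ G) : Set M) ⊆ V := by
      rw [Finset.coe_union]
      exact union_subset hFV hGV
    refine ⟨insert f H, Finset.insert_nonempty f H, ?_, ?_, fun p hp =>
      hwH p fun e he => hp e (Finset.mem_insert_of_mem he)⟩
    · rw [Finset.coe_insert, insert_subset_iff]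
      exact ⟨hFV hf, (Finset.coe_subset.2 hH).trans hFG⟩
    · exact (Finset.card_insert_le f H).trans (by omega)
  exact ⟨closure C, hLc.of_isClosed_subset isClosed_closure
    (closure_minimal hCL hLc.isClosed), hC.closure,
    Filter.mem_of_superset hV (hVC.trans subset_closure)⟩

/-! ### Finiteness of full additive intervals -/

/-- Beyond each of its points, an additive ray leaves every compact set. -/
theorem IsAdditiveRay.exists_mem_frontier [PreconnectedSpace M] {a x : M} {R L : Set M}
    (hR : IsAdditiveRay a R) (hx : x ∈ R) (hL : IsCompact L) (hxL : x ∈ L) :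
    ∃ y ∈ frontier L, y ∈ R ∧ x ∈ interval a y := by
  obtain ⟨⟨r, hr, hr0, rfl⟩, hconv, -⟩ := hR
  obtain ⟨t, rfl⟩ := hx
  have hcomp : IsCompact (r ⁻¹' L) := hr.isCompact_preimage hL
  obtain ⟨T, hT⟩ := hcomp.bddAbove
  have hout : r (max t (T + 1)) ∉ L := fun h =>
    absurd ((le_max_right t (T + 1)).trans (hT h)) (by simp)
  obtain ⟨_, ⟨s, hs, rfl⟩, hsL⟩ := inter_frontier_nonempty_of_isPreconnected
    (isPreconnected_Ici.image r hr.continuous.continuousOn : IsPreconnected (r '' Ici t))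
    ⟨r t, mem_image_of_mem r self_mem_Ici, hxL⟩ ⟨_, mem_image_of_mem r (le_max_left t _), hout⟩
  -- the connected set `[a, r s]` contains `r 0` and `r s`, hence also `r t`
  refine ⟨r s, hsL, mem_range_self s, ?_⟩
  have hsub : interval a (r s) ⊆ range r :=
    hconv a ⟨0, hr0⟩ (r s) (mem_range_self s)
  have hpre : IsPreconnected (r ⁻¹' interval a (r s)) := by
    rw [← hr.isInducing.isPreconnected_image, image_preimage_eq_of_subset hsub]
    exact isPreconnected_interval a (r s)
  have h0 : (0 : ℝ≥0) ∈ r ⁻¹' interval a (r s) := by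
    rw [mem_preimage, hr0]
    exact left_mem_interval a (r s)
  exact hpre.Icc_subset h0 (right_mem_interval a (r s)) ⟨zero_le, hs⟩

/-- For an infinite family of full additive intervals `[a, x i] = R i ∩ K`, let the `x i` converge
to `x`, and let `y i ∈ R i` beyond `x i` converge to a point `y ≠ x`. Then `med a (y i) (y j)`
tends to `y`, so it lies beyond `x i` and `x j` on both rays; hence `x i ∈ R j ∩ K = [a, x j]` and
conversely, which forces `x i = x j`. -/
theorem finite_setOf_isFullAdditiveInterval [LocallyCompactSpace M] [PreconnectedSpace M]
    {K : Set M} (hK : IsCompact K) (a : M) : {I : Set M | IsFullAdditiveInterval K a I}.Finite := by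
  by_contra hinf
  let S := {I : Set M | IsFullAdditiveInterval K a I}
  have : Infinite S := Set.Infinite.to_subtype hinf
  have hS : ∀ i : S, ∃ x R, (i : Set M) = interval a x ∧ IsAdditiveRay a R ∧ (i : Set M) = R ∩ K :=
    fun i => by
      obtain ⟨⟨x, hx, -⟩, R, hR, hRK⟩ := i.2
      exact ⟨x, R, hx, hR, hRK⟩
  choose x R hx hR hRK using hS
  have hxRK (i : S) : x i ∈ R i ∩ K := by
    rw [← hRK, hx]
    exact right_mem_interval a (x i)
  let u : Ultrafilter S := Filter.hyperfilter S
  obtain ⟨x₀, -, hx₀⟩ := hK.ultrafilter_le_nhds (u.map x)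
    (Filter.tendsto_principal.2 (Filter.Eventually.of_forall fun i => (hxRK i).2))
  obtain ⟨L, hLc, hL⟩ := exists_compact_mem_nhds x₀
  have hxL : ∀ᶠ i in (u : Filter S), x i ∈ L := hx₀ hL
  have hexit : ∀ i, ∃ y, x i ∈ L → y ∈ frontier L ∧ y ∈ R i ∧ x i ∈ interval a y := by
    intro i
    by_cases h : x i ∈ L
    · obtain ⟨y, h1, h2, h3⟩ := (hR i).exists_mem_frontier (hxRK i).1 hLc h
      exact ⟨y, fun _ => ⟨h1, h2, h3⟩⟩
    · exact ⟨a, fun h' => absurd h' h⟩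
  choose y hy using hexit
  have hfr : IsCompact (frontier L) := hLc.of_isClosed_subset isClosed_frontier
    hLc.isClosed.frontier_subset
  obtain ⟨y₀, hy₀L, hy₀⟩ := hfr.ultrafilter_le_nhds (u.map y)
    (Filter.le_principal_iff.2 (hxL.mono fun i hi => (hy i hi).1))
  have hxt : Filter.Tendsto x u (𝓝 x₀) := hx₀
  have hyt : Filter.Tendsto y u (𝓝 y₀) := hy₀
  have hne : x₀ ≠ y₀ := by
    rintro rfl
    exact hy₀L.2 (mem_interior_iff_mem_nhds.2 hL)
  have hmem : x₀ ∈ interval a y₀ :=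
    tendsto_nhds_unique_of_eventuallyEq (tendsto_med tendsto_const_nhds hyt hxt) hxt
      (hxL.mono fun i hi => (hy i hi).2.2)
  have hmem' : med a x₀ y₀ ≠ y₀ := fun h => hne (interval_antisymm hmem h)
  -- on the product of the ultrafilter with itself, the branching point tends to `y₀`
  have hz : Filter.Tendsto (fun p : S × S => med a (y p.1) (y p.2)) ((u : Filter S) ×ˢ u) (𝓝 y₀) := by
    have := tendsto_med (tendsto_const_nhds (x := a)) (hyt.comp Filter.tendsto_fst)
      (hyt.comp (Filter.tendsto_snd (f := (u : Filter S)) (g := (u : Filter S))))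
    rwa [med_self_right] at this
  have hev : ∀ᶠ p : S × S in (u : Filter S) ×ˢ u,
      med a (x p.1) (med a (y p.1) (y p.2)) ≠ med a (y p.1) (y p.2) :=
    ((tendsto_med tendsto_const_nhds (hxt.comp Filter.tendsto_fst) hz).prodMk_nhds hz).eventually
      ((isOpen_ne_fun continuous_fst continuous_snd).eventually_mem hmem')
  obtain ⟨A, hA, hAev⟩ := (Filter.eventually_prod_self_iff (r := fun i j =>
    med a (x i) (med a (y i) (y j)) ≠ med a (y i) (y j) ∧ x i ∈ L ∧ x j ∈ L)).1
    (hev.and (hxL.prod_mk hxL))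
  -- `[a, y i]` is additive, and `med a (y i) (y j)` is not in `[a, x i]`
  have key : ∀ i ∈ A, ∀ j ∈ A, x i ∈ interval a (x j) := by
    intro i hi j hj
    obtain ⟨h, hiL, hjL⟩ := hAev i hi j hj
    obtain ⟨-, hyi, hxi⟩ := hy i hiL
    obtain ⟨-, hyj, -⟩ := hy j hjL
    have haR : a ∈ R j := by
      obtain ⟨⟨r, -, hr0, hr⟩, -⟩ := hR j
      exact hr ▸ ⟨0, hr0⟩
    have hzR : interval a (med a (y i) (y j)) ⊆ R j := by
      refine (hR j).2.1 a haR _ ((hR j).2.1 a haR (y j) hyj ?_)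
      rw [med_swap_right]
      exact med_mem_interval _ _ _
    have hxz : x i ∈ interval a (med a (y i) (y j)) := by
      have hadd := (hR i).2.2 (y i) hyi _ (med_mem_interval a (y i) (y j))
      rw [← hadd] at hxi
      exact hxi.resolve_right fun h' =>
        h (mem_interval_left_of_mem_right (med_mem_interval a (y i) (y j)) h')
    rw [← hx, hRK]
    exact ⟨hzR hxz, (hxRK i).2⟩
  have hsub : A.Subsingleton := by
    intro i hi j hj
    have : x i = x j := interval_antisymm (key i hi j hj) (key j hj i hi)
    exact Subtype.ext (by rw [hx i, hx j, this])
  exact Filter.notMem_hyperfilter_of_finite hsub.finite hA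

end Topology

end MedianAlgebra

theorem mainTheorem7 {M : Type*} [TopologicalSpace M] [MedianAlgebra M]
    [TopologicalMedianAlgebra M] [LocallyCompactSpace M] [ConnectedSpace M]
    (hrank : MedianAlgebra.rank M < ⊤)
    (hext : ∀ a b : M, MedianAlgebra.IsAdditive a b →
      ∃ R : Set M, MedianAlgebra.IsAdditiveRay a R ∧ MedianAlgebra.interval a b ⊆ R)
    (a : M) :
    ∃ K : Set M, IsCompact K ∧ MedianAlgebra.IsConvex K ∧ K ∈ 𝓝 a ∧
      {I : Set M | MedianAlgebra.IsFullAdditiveInterval K a I}.Finite := by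
  obtain ⟨K, hK, hconv, ha⟩ := MedianAlgebra.exists_isCompact_isConvex_mem_nhds hrank a
  exact ⟨K, hK, hconv, ha, MedianAlgebra.finite_setOf_isFullAdditiveInterval hK a⟩
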